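/- Corollary 5.3. An ideal on a countable set $M$ is a family $\mathcal I\subseteq\mathcal P(M)$ that is closed under subsets and finite unions, contains all finite subsets of $M$, and satisfies $M\notin\mathcal I$; write $\mathcal I^+=\mathcal P(M)\setminus\mathcal I$. It is $\mathbf{F_\sigma}$ if it is an $\mathbf{F_\sigma}$ subset of $\mathcal P(M)$, identified with $\{0,1\}^M$ (product topology, $\{0,1\}$ discrete) via characteristic functions. A topological space $X$ is $\mathrm{BW}(\mathcal I)$ if for every $(x_m)_{m\in M}$ in $X$ there are $A\in\mathcal I^+$ and $x\in X$ such that $\{m\in A: x_m\notin U\}\in\mathcal I$ for every open neighbourhood $U$ of $x$. For an ideal $\mathcal I$ on $M$ and an ideal $\mathcal J$ on $N$, write $\mathcal I\leq_{BW}\mathcal J$ if there is $f:N\to M$ such that for every $A\in\mathcal J^+$ there is $B\subseteq f[A]$, $B\in\mathcal I^+$, such that $A\cap f^{-1}[C]\in\mathcal J^+$ for every $C\subseteq M$ with $C\cap B\in\mathcal I^+$. Assume CH ($\aleph_1=2^{\aleph_0}$). Let $\mathcal I$ and $\mathcal J$ be $\mathbf{F_\sigma}$ ideals on countable sets. Then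 the following are equivalent: (a) $\mathcal J\not\leq_{BW}\mathcal I$; (b) there is a $\mathrm{BW}(\mathcal I)$ space which is not $\mathrm{BW}(\mathcal J)$; (c) there is a Hausdorff non-compact $\mathrm{BW}(\mathcal I)$ space which is not $\mathrm{BW}(\mathcal J)$. Consequently, $\mathcal I\leq_{BW}\mathcal J$ if and only if every $\mathrm{BW}(\mathcal J)$ space is $\mathrm{BW}(\mathcal I)$. -/

import Mathlib

/-- An ideal on a set `M`: a nonempty family of subsets of `M` closed under subsets and finite
unions, which is proper and contains all finite subsets of `M`. -/
structure SetIdeal (M : Type*) extends Order.Ideal (Set M) where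
  univ_notMem' : (Set.univ : Set M) ∉ toIdeal
  finite_mem' : ∀ A : Set M, A.Finite → A ∈ toIdeal

namespace SetIdeal

/-- The ideal as a family of subsets of `M`. -/
def sets {M : Type*} (I : SetIdeal M) : Set (Set M) := {A | A ∈ I.toIdeal}

/-- `A` is `I`-positive. -/
def Positive {M : Type*} (I : SetIdeal M) (A : Set M) : Prop := A ∉ I.sets

/-- `I` is an `F_σ` subset of the power set of `M`, topologized by identifying subsets of `M` with
their characteristic functions in `2 ^ M` (product topology, `2 = Bool` discrete). -/
def IsFSigma {M : Type*} (I : SetIdeal M) : Prop :=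
  ∃ F : ℕ → Set (M → Bool), (∀ n, IsClosed (F n)) ∧ Set.boolIndicator '' I.sets = ⋃ n, F n

/-- The family `(x m)_{m ∈ A}` is `I`-convergent in the topological space `X`. -/
def Convergent {M : Type*} (I : SetIdeal M) {X : Type*} [TopologicalSpace X]
    (x : M → X) (A : Set M) : Prop :=
  ∃ l : X, ∀ U : Set X, IsOpen U → l ∈ U → {m | m ∈ A ∧ x m ∉ U} ∈ I.sets

/-- The topological space `X` has the property `BW(I)`. -/
def BW {M : Type*} (I : SetIdeal M) (X : Type*) [TopologicalSpace X] : Prop :=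
  ∀ x : M → X, ∃ A : Set M, I.Positive A ∧ I.Convergent x A

/-- The relation `I ≤_BW J`. -/
def BWLe {M N : Type*} (I : SetIdeal M) (J : SetIdeal N) : Prop :=
  ∃ f : N → M, ∀ A : Set N, J.Positive A →
    ∃ B : Set M, B ⊆ f '' A ∧ I.Positive B ∧
      ∀ C : Set M, I.Positive (C ∩ B) → J.Positive (A ∩ f ⁻¹' C)

end SetIdeal

universe u v w

/-! If `f` witnesses `J.BWLe I`, a sequence `y` inherits `J`-convergence on a positive set from the
`I`-convergence of `y ∘ f` (`BWLe.BW`). Otherwise a counterexample lives in the cube `K → Bool`,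
with `K` of type ω₁: the points of countable support plus the columns of a family `D : K → Set N`.
If `D` splits every `J`-positive set, the sequence of columns has no `J`-convergent restriction to a
positive set. If every `f : M → N` with fibres in `I` has an `I`-positive `A` on which all but
countably many `D k` have small preimage, the space is `I.BW`. Under CH the positive sets and the
maps are listed along ω₁, so each `D k` has one set to split and only countably many maps to
respect. The `F_σ` hypothesis makes positivity a countable list of requirements met by finite sets;
this yields the needed diagonalisations and splittings. -/

namespace SetIdeal

/-! ### Ideals, positive sets and convergence -/

section Basic

variable {M : Type*} {I : SetIdeal M} {A B : Set M}

theorem sets_mono (h : A ⊆ B) (hB : B ∈ I.sets) : A ∈ I.sets :=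
  I.toIdeal.lower h hB

theorem union_mem_sets (hA : A ∈ I.sets) (hB : B ∈ I.sets) : A ∪ B ∈ I.sets :=
  Order.Ideal.sup_mem hA hB

theorem finite_mem_sets (h : A.Finite) : A ∈ I.sets := I.finite_mem' A h

theorem univ_notMem_sets : (Set.univ : Set M) ∉ I.sets := I.univ_notMem'

theorem empty_mem_sets : (∅ : Set M) ∈ I.sets := finite_mem_sets Set.finite_empty

theorem Positive.mono (hA : I.Positive A) (h : A ⊆ B) : I.Positive B :=
  fun hB => hA (sets_mono h hB)

theorem Positive.diff (hA : I.Positive A) (hB : B ∈ I.sets) : I.Positive (A \ B) := fun h =>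
  hA (sets_mono (fun x hx => by by_cases hxB : x ∈ B <;> simp [hx, hxB]) (union_mem_sets h hB))

theorem Positive.inter_or_diff (hA : I.Positive A) (C : Set M) :
    I.Positive (A ∩ C) ∨ I.Positive (A \ C) := by
  by_contra! h
  exact hA (sets_mono (Set.inter_union_sdiff A C).ge
    (union_mem_sets (not_not.1 h.1) (not_not.1 h.2)))

theorem inter_preimage_mem_sets_of_finite {N : Type*} {f : M → N}
    (hf : ∀ y, A ∩ f ⁻¹' {y} ∈ I.sets) {s : Set N} (hs : s.Finite) :
    A ∩ f ⁻¹' s ∈ I.sets := by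
  induction s, hs using Set.Finite.induction_on with
  | empty => simpa using empty_mem_sets
  | @insert a s _ _ ih =>
    rw [Set.insert_eq, Set.preimage_union, Set.inter_union_distrib_left]
    exact union_mem_sets (hf a) ih

/-- The sets containing `A` up to an element of the ideal. -/
def filterOn (I : SetIdeal M) (A : Set M) : Filter M where
  sets := {S | A \ S ∈ I.sets}
  univ_sets := by simpa using empty_mem_sets
  sets_of_superset h hST := sets_mono (Set.sdiff_subset_sdiff_right hST) h
  inter_sets {S T} hS hT := by
    simp only [Set.mem_ofPred_eq, Set.sdiff_inter] at *
    exact union_mem_sets hS hT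

theorem convergent_iff_exists_tendsto {X : Type*} [TopologicalSpace X] {x : M → X} :
    I.Convergent x A ↔ ∃ l, Filter.Tendsto x (I.filterOn A) (nhds l) := by
  refine exists_congr fun l => ?_
  rw [tendsto_nhds]
  rfl

/-- A sequence in a subspace of a Cantor cube converges to `z` if it does so coordinatewise. -/
theorem convergent_subtype_bool {K : Type*} {p : (K → Bool) → Prop} {x : M → Subtype p}
    {z : K → Bool} (hz : p z) (h : ∀ k, {m | m ∈ A ∧ (x m).1 k ≠ z k} ∈ I.sets) :
    I.Convergent x A := by
  refine convergent_iff_exists_tendsto.2 ⟨⟨z, hz⟩, ?_⟩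
  rw [tendsto_subtype_rng, tendsto_pi_nhds]
  intro k
  rw [nhds_discrete, Filter.tendsto_pure]
  exact h k

/-- If `x` is constant on a positive set, then it converges there. -/
theorem convergent_of_eqOn {X : Type*} [TopologicalSpace X] {x : M → X} {l : X}
    (h : ∀ m ∈ A, x m = l) : I.Convergent x A := by
  refine ⟨l, fun U _ hl => sets_mono ?_ empty_mem_sets⟩
  rintro m ⟨hm, hmU⟩
  exact hmU (h m hm ▸ hl)

end Basic

/-! ### Diagonalisation and splitting for `F_σ` ideals -/

section FSigma

variable {M : Type*} {I : SetIdeal M} {A : Set M}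

/-- Positivity with respect to an `F_σ` ideal is witnessed by countably many requirements, each
of which is met by a finite subset. -/
theorem IsFSigma.exists_witnesses (hI : I.IsFSigma) :
    ∃ S : ℕ → Set (Set M), ∀ A, I.Positive A ↔ ∀ n, ∃ s ∈ S n, s.Finite ∧ s ⊆ A := by
  classical
  obtain ⟨F, hF, hU⟩ := hI
  -- View `F n` as a family of sets; `S n` consists of the sets contained in no member of it. If
  -- every finite subset of `A` lay in a member, compactness would put `A` inside one member, hence
  -- in `I`.
  refine ⟨fun n => {s | ∀ b ∈ F n, ∃ m ∈ s, b m = false}, fun A => ⟨fun hA n => ?_, ?_⟩⟩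
  · by_contra! hn
    have hne : (⋂ s : Finset A, {b | b ∈ F n ∧ ∀ m ∈ s, b m = true}).Nonempty := by
      refine IsCompact.nonempty_iInter_of_directed_nonempty_isCompact_isClosed _ ?_ ?_ ?_ ?_
      · intro s t
        exact ⟨s ∪ t, fun b hb => ⟨hb.1, fun m hm => hb.2 m (Finset.mem_union_left _ hm)⟩,
          fun b hb => ⟨hb.1, fun m hm => hb.2 m (Finset.mem_union_right _ hm)⟩⟩
      · intro s
        by_contra hs
        refine hn (Subtype.val '' (s : Set A)) ?_ (s.finite_toSet.image _) (by simp)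
        intro b hb
        by_contra! hb'
        refine hs ⟨b, hb, fun m hm => ?_⟩
        simpa using hb' m ⟨m, hm, rfl⟩
      all_goals
        intro s
        have : IsClosed {b | b ∈ F n ∧ ∀ m ∈ s, b m = true} := by
          refine IsClosed.inter (s₂ := {b | ∀ m ∈ s, b m = true}) (hF n) ?_
          simp only [Set.ofPred_forall]
          exact isClosed_iInter fun m => isClosed_iInter fun _ =>
            isClosed_eq (continuous_apply _) continuous_const
        first
          | exact this
          | exact this.isCompact
    obtain ⟨b, hb⟩ := hne
    simp only [Set.mem_iInter, Set.mem_ofPred_eq] at hb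
    have hbU : b ∈ Set.boolIndicator '' I.sets := hU ▸ Set.mem_iUnion.2 ⟨n, (hb ∅).1⟩
    obtain ⟨B, hB, rfl⟩ := hbU
    refine hA (sets_mono (fun m hm => ?_) hB)
    exact (Set.mem_iff_boolIndicator B m).2 ((hb {⟨m, hm⟩}).2 ⟨m, hm⟩ (by simp))
  · intro h hA
    have : A.boolIndicator ∈ ⋃ n, F n := hU ▸ ⟨A, hA, rfl⟩
    obtain ⟨n, hn⟩ := Set.mem_iUnion.1 this
    obtain ⟨s, hs, -, hsA⟩ := h n
    obtain ⟨m, hm, hmA⟩ := hs _ hn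
    exact (Set.notMem_iff_boolIndicator A m).2 hmA (hsA hm)

/-- `F_σ` ideals are `P⁺`. -/
theorem IsFSigma.exists_pseudointersection (hI : I.IsFSigma) {A : ℕ → Set M} (hA : Antitone A)
    (hpos : ∀ n, I.Positive (A n)) :
    ∃ B ⊆ A 0, I.Positive B ∧ ∀ n, (B \ A n).Finite := by
  obtain ⟨S, hS⟩ := hI.exists_witnesses
  -- The finite set `s n ⊆ A n` meets requirement `n`. The union of all of them is positive, and
  -- only those with index below `n` can leave `A n`.
  choose s hsS hfin hsub using fun n => (hS _).1 (hpos n) n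
  refine ⟨⋃ n, s n, Set.iUnion_subset fun n => (hsub n).trans (hA (Nat.zero_le n)),
    (hS _).2 fun n => ⟨s n, hsS n, hfin n, Set.subset_iUnion s n⟩, fun n => ?_⟩
  refine ((Set.finite_Iio n).biUnion fun k _ => hfin k).subset ?_
  rintro x ⟨hx, hxn⟩
  obtain ⟨k, hk⟩ := Set.mem_iUnion.1 hx
  exact Set.mem_biUnion (not_le.1 fun h : n ≤ k => hxn (hA h (hsub k hk))) hk

/-- Countably many requirements, each dense among the positive sets, can be met at once up to
finite sets. -/
theorem IsFSigma.exists_positive_forall (hI : I.IsFSigma) {ι : Type*} [Countable ι]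
    (Q : ι → Set M → Prop)
    (hQ : ∀ i A, I.Positive A → ∃ B ⊆ A, I.Positive B ∧ Q i B) (hA : I.Positive A) :
    ∃ B ⊆ A, I.Positive B ∧ ∀ i, ∃ C, Q i C ∧ (B \ C).Finite := by
  cases isEmpty_or_nonempty ι
  · exact ⟨A, subset_rfl, hA, isEmptyElim⟩
  obtain ⟨e, he⟩ := exists_surjective_nat ι
  choose g hgsub hgpos hgQ using hQ
  let a : ℕ → {B : Set M // I.Positive B} :=
    fun n => Nat.rec ⟨A, hA⟩ (fun n B => ⟨g (e n) B.1 B.2, hgpos _ _ _⟩) n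
  have ha : Antitone fun n => (a n).1 := antitone_nat_of_succ_le fun n => hgsub _ _ _
  obtain ⟨B, hBA, hB, hfin⟩ := hI.exists_pseudointersection ha fun n => (a n).2
  refine ⟨B, hBA, hB, fun i => ?_⟩
  obtain ⟨n, rfl⟩ := he i
  exact ⟨(a (n + 1)).1, hgQ _ _ _, hfin (n + 1)⟩

/-- A positive set of an `F_σ` ideal splits into two positive sets. -/
theorem IsFSigma.exists_split (hI : I.IsFSigma) (hA : I.Positive A) :
    ∃ B ⊆ A, I.Positive B ∧ I.Positive (A \ B) := by
  obtain ⟨S, hS⟩ := hI.exists_witnesses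
  have key : ∀ (n : ℕ) (U : {U : Set M // U.Finite}), ∃ s ∈ S n, s.Finite ∧ s ⊆ A \ U.1 :=
    fun n U => (hS _).1 (hA.diff (finite_mem_sets U.2)) n
  choose s hsS hfin hsub using key
  -- The pieces `u n` are chosen outside the finite set `U n` of points already used. The index `n /
  -- 2` meets each requirement twice: the even piece serves `B`, the odd one serves `A \ B`.
  let U : ℕ → {U : Set M // U.Finite} :=
    fun n => Nat.rec ⟨∅, Set.finite_empty⟩
      (fun n U => ⟨U.1 ∪ s (n / 2) U, U.2.union (hfin _ _)⟩) n
  let u : ℕ → Set M := fun n => s (n / 2) (U n)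
  have hU : Monotone fun n => (U n).1 := monotone_nat_of_le_succ fun n => Set.subset_union_left
  have hlt : ∀ {m n}, m < n → Disjoint (u m) (u n) := fun {m n} h =>
    Set.disjoint_left.2 fun x hm hn =>
      (hsub _ _ hn).2 (hU (Nat.succ_le_of_lt h) (Set.mem_union_right _ hm))
  have huA : ∀ n, u n ⊆ A := fun n x hx => (hsub _ _ hx).1
  have huS : ∀ n, u n ∈ S (n / 2) := fun n => hsS _ _
  refine ⟨⋃ n, u (2 * n), Set.iUnion_subset fun n => huA _, (hS _).2 fun n => ?_,
    (hS _).2 fun n => ?_⟩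
  · refine ⟨u (2 * n), ?_, hfin _ _, Set.subset_iUnion (fun n => u (2 * n)) n⟩
    have := huS (2 * n)
    rwa [Nat.mul_div_cancel_left n two_pos] at this
  · refine ⟨u (2 * n + 1), ?_, hfin _ _, fun x hx => ⟨huA _ hx, fun hx' => ?_⟩⟩
    · have := huS (2 * n + 1)
      rwa [show (2 * n + 1) / 2 = n by omega] at this
    · obtain ⟨k, hk⟩ := Set.mem_iUnion.1 hx'
      rcases lt_or_gt_of_ne (show 2 * k ≠ 2 * n + 1 by omega) with h | h
      · exact Set.disjoint_left.1 (hlt h) hk hx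
      · exact Set.disjoint_left.1 (hlt h) hx hk

end FSigma

/-! ### The test space in the Cantor cube -/

section Cube

variable {M : Type*} {I : SetIdeal M} {A : Set M} {K : Type*}

/-- A sequence in the Cantor cube almost all of whose coordinates converge to `false` along `A`
converges along a positive subset of `A`. -/
theorem IsFSigma.exists_limit_of_countable (hI : I.IsFSigma) (hA : I.Positive A)
    (x : M → K → Bool) {S : Set K} (hS : S.Countable)
    (h : ∀ k ∉ S, {m | m ∈ A ∧ x m k = true} ∈ I.sets) :
    ∃ B ⊆ A, I.Positive B ∧ ∃ z : K → Bool, {k | z k = true}.Countable ∧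
      ∀ k, {m | m ∈ B ∧ x m k ≠ z k} ∈ I.sets := by
  classical
  have := hS.to_subtype
  have hdec : ∀ (k : S) (C : Set M), I.Positive C →
      ∃ C' ⊆ C, I.Positive C' ∧ ∃ b, ∀ m ∈ C', x m k = b := by
    intro k C hC
    rcases hC.inter_or_diff {m | x m k = true} with h' | h'
    · exact ⟨_, Set.inter_subset_left, h', true, fun m hm => hm.2⟩
    · exact ⟨_, Set.sdiff_subset, h', false, fun m hm => by simpa using hm.2⟩
  obtain ⟨B, hBA, hB, hQ⟩ := hI.exists_positive_forall _ hdec hA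
  choose C hC hfin using hQ
  choose b hb using hC
  -- The limit takes the stabilised values on `S` and `false` elsewhere, so its support is
  -- countable.
  refine ⟨B, hBA, hB, fun k => if hk : k ∈ S then b ⟨k, hk⟩ else false,
    hS.mono fun k hk => ?_, fun k => ?_⟩
  · by_contra hkS
    simp [hkS] at hk
  · by_cases hk : k ∈ S
    · refine finite_mem_sets ((hfin ⟨k, hk⟩).subset ?_)
      rintro m ⟨hm, hne⟩
      refine ⟨hm, fun hmC => hne ?_⟩
      simpa [hk] using hb ⟨k, hk⟩ m hmC
    · refine sets_mono ?_ (h k hk)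
      rintro m ⟨hm, hne⟩
      exact ⟨hBA hm, by simpa [hk] using hne⟩

/-- The points of the Cantor cube with countable support, together with the columns of the
family `D`. -/
def columnSpace {N : Type*} (D : K → Set N) : Set (K → Bool) :=
  {z | {k | z k = true}.Countable} ∪ Set.range fun n k => (D k).boolIndicator n

variable {N : Type*} {D : K → Set N}

theorem dense_columnSpace : Dense (columnSpace D) := by
  classical
  intro z
  refine mem_closure_of_tendsto (b := Filter.atTop)
    (f := fun (s : Finset K) k => if k ∈ s then z k else false) ?_ (Filter.Eventually.of_forall ?_)
  · rw [tendsto_pi_nhds]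
    intro k
    refine tendsto_const_nhds.congr' ?_
    filter_upwards [Filter.eventually_ge_atTop {k}] with s hs
    rw [if_pos (hs (by simp))]
  · intro s
    refine Or.inl (s.countable_toSet.mono fun k hk => ?_)
    by_contra hks
    have : k ∉ s := hks
    simp [this] at hk

/-- Compactness would make this dense subspace closed, hence the whole cube. The points with exactly
one `false` coordinate have uncountable support, so they would all be columns, but there are
uncountably many of them and only countably many columns. -/
theorem not_compactSpace_columnSpace [Countable N] [Uncountable K] :
    ¬ CompactSpace (columnSpace D) := by
  classical
  intro h
  have huniv : columnSpace D = Set.univ := by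
    rw [← (isCompact_iff_compactSpace.2 h).isClosed.closure_eq]
    exact dense_columnSpace.closure_eq
  have hmem : ∀ j : K, ∃ n : N, (fun k => (D k).boolIndicator n) = fun k => !decide (k = j) := by
    intro j
    rcases huniv.ge (Set.mem_univ fun k => !decide (k = j)) with hc | hr
    · refine absurd ?_ (Set.not_countable_univ (α := K))
      refine (hc.union (Set.countable_singleton j)).mono fun k _ => ?_
      by_cases hk : k = j <;> simp [hk]
    · exact hr
  choose n hn using hmem
  refine not_injective_uncountable_countable n fun i j hij => ?_
  by_contra hne
  have := congr_fun ((hn i).symm.trans (hij ▸ hn j)) i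
  simp [hne] at this

/-- Convergence of the columns along `B` would force, at each coordinate `k`, one of `B ∩ D k` and
`B \ D k` into `J`. -/
theorem not_BW_columnSpace {J : SetIdeal N}
    (hD : ∀ B, J.Positive B → ∃ k, J.Positive (B ∩ D k) ∧ J.Positive (B \ D k)) :
    ¬ J.BW (columnSpace D) := by
  intro h
  obtain ⟨B, hB, hconv⟩ := h fun n => ⟨fun k => (D k).boolIndicator n, Or.inr ⟨n, rfl⟩⟩
  obtain ⟨l, hl⟩ := convergent_iff_exists_tendsto.1 hconv
  rw [tendsto_subtype_rng, tendsto_pi_nhds] at hl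
  obtain ⟨k, hk₁, hk₂⟩ := hD B hB
  have hlk := hl k
  rw [nhds_discrete, Filter.tendsto_pure] at hlk
  have hlk' : B \ {n | (D k).boolIndicator n = l.1 k} ∈ J.sets := hlk
  cases hb : l.1 k
  · refine hk₁ (sets_mono ?_ hlk')
    rintro n ⟨hn, hnD⟩
    exact ⟨hn, by simp [hb, (Set.mem_iff_boolIndicator _ _).1 hnD]⟩
  · refine hk₂ (sets_mono ?_ hlk')
    rintro n ⟨hn, hnD⟩
    exact ⟨hn, by simp [hb, (Set.notMem_iff_boolIndicator _ _).1 hnD]⟩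

/-- Either positively many terms have countable support, and countability of `M` bounds the union of
these supports; or almost all terms are columns. In the latter case the column index has a positive
fibre, where the sequence is constant, or `hD` leaves countably many coordinates to stabilise. -/
theorem BW_columnSpace [Countable M] (hI : I.IsFSigma)
    (hD : ∀ f : M → N, (∀ y, f ⁻¹' {y} ∈ I.sets) →
      ∃ A, I.Positive A ∧ {k | I.Positive (A ∩ f ⁻¹' D k)}.Countable) :
    I.BW (columnSpace D) := by
  classical
  intro x
  set s : Set M := {m | {k | (x m).1 k = true}.Countable} with hs
  by_cases hsI : I.Positive s
  · have hS : (⋃ m ∈ s, {k | (x m).1 k = true}).Countable :=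
      (Set.to_countable s).biUnion fun m hm => hm
    obtain ⟨B, -, hB, z, hz, hlim⟩ := hI.exists_limit_of_countable hsI (fun m => (x m).1) hS
      fun k hk => sets_mono (fun m hm => (hk (Set.mem_biUnion hm.1 hm.2)).elim) empty_mem_sets
    exact ⟨B, hB, convergent_subtype_bool (Or.inl hz) hlim⟩
  have hsI' : s ∈ I.sets := not_not.1 hsI
  have hcol : ∀ m ∉ s, ∃ n, (fun k => (D k).boolIndicator n) = (x m).1 := fun m hm =>
    (x m).2.resolve_left hm
  have hne : (sᶜ).Nonempty := by
    rw [Set.nonempty_compl]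
    rintro h
    exact univ_notMem_sets (h ▸ hsI')
  obtain ⟨m₀, hm₀⟩ := hne
  -- The value of `g` on `s` is arbitrary, which is harmless because `s` is in `I`.
  let g : M → N := fun m => if hm : m ∈ s then (hcol m₀ hm₀).choose else (hcol m hm).choose
  have hg : ∀ m ∉ s, ∀ k, (x m).1 k = (D k).boolIndicator (g m) := fun m hm k => by
    simp only [g, dif_neg hm]
    exact (congr_fun (hcol m hm).choose_spec k).symm
  by_cases hconst : ∀ y, g ⁻¹' {y} ∈ I.sets
  · obtain ⟨A, hA, hcount⟩ := hD g hconst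
    have hsmall : ∀ k ∉ {k | I.Positive (A ∩ g ⁻¹' D k)},
        {m | m ∈ A \ s ∧ (x m).1 k = true} ∈ I.sets := by
      intro k hk
      refine sets_mono ?_ (not_not.1 hk : A ∩ g ⁻¹' D k ∈ I.sets)
      rintro m ⟨⟨hm, hms⟩, hmk⟩
      exact ⟨hm, (Set.mem_iff_boolIndicator _ _).2 (hg m hms k ▸ hmk)⟩
    obtain ⟨B, -, hB, z, hz, hlim⟩ := hI.exists_limit_of_countable (hA.diff hsI')
      (fun m => (x m).1) hcount hsmall
    exact ⟨B, hB, convergent_subtype_bool (Or.inl hz) hlim⟩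
  · push Not at hconst
    obtain ⟨y, hy⟩ := hconst
    have hpos : I.Positive (g ⁻¹' {y} \ s) := Positive.diff hy hsI'
    refine ⟨_, hpos, convergent_of_eqOn (l := ⟨fun k => (D k).boolIndicator y, Or.inr ⟨y, rfl⟩⟩)
      fun m hm => Subtype.ext (funext fun k => ?_)⟩
    rw [hg m hm.2 k, show g m = y from hm.1]

end Cube

/-! ### The order `BWLe` and the splitting family -/

section BWLe

variable {M N : Type*} {I : SetIdeal M} {J : SetIdeal N}

/-- For an open neighbourhood `U` of the limit of `y ∘ f` along `A`, the positivity transfer is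
applied to `C = {n | y n ∉ U}`: were `C ∩ B` positive, so would be the exceptional set of `y ∘ f`.
-/
theorem BWLe.BW (h : J.BWLe I) {X : Type*} [TopologicalSpace X] (hX : I.BW X) : J.BW X := by
  obtain ⟨f, hf⟩ := h
  intro y
  obtain ⟨A, hA, l, hl⟩ := hX (y ∘ f)
  obtain ⟨B, -, hB, hC⟩ := hf A hA
  refine ⟨B, hB, l, fun U hU hlU => ?_⟩
  by_contra hpos
  have hpos' : J.Positive ({n | y n ∉ U} ∩ B) :=
    Positive.mono hpos fun n hn => ⟨hn.2, hn.1⟩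
  exact hC _ hpos' (hl U hU hlU)

/-- A positive set of an `F_σ` ideal `J` contains a positive subset, with positive complement,
which is small with respect to countably many sequences witnessing the failure of `BWLe`. -/
theorem IsFSigma.exists_small_splitting (hJ : J.IsFSigma) {ι : Type*} [Countable ι]
    {f : ι → M → N} {A : ι → Set M} (hf : ∀ i y, A i ∩ f i ⁻¹' {y} ∈ I.sets)
    (hA : ∀ i, ∀ B ⊆ f i '' A i, J.Positive B →
      ∃ C, J.Positive (C ∩ B) ∧ A i ∩ f i ⁻¹' C ∈ I.sets)
    {B : Set N} (hB : J.Positive B) :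
    ∃ D, J.Positive (B ∩ D) ∧ J.Positive (B \ D) ∧ ∀ i, A i ∩ f i ⁻¹' D ∈ I.sets := by
  have hsmall : ∀ (i : ι) (C : Set N), J.Positive C →
      ∃ C' ⊆ C, J.Positive C' ∧ A i ∩ f i ⁻¹' C' ∈ I.sets := by
    intro i C hC
    -- Inside the image of `A i` the hypothesis `hA` applies; outside it the relevant preimage is
    -- empty.
    rcases hC.inter_or_diff (f i '' A i) with h | h
    · obtain ⟨E, hE, hE'⟩ := hA i _ Set.inter_subset_right h
      exact ⟨E ∩ (C ∩ f i '' A i), fun n hn => hn.2.1, hE,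
        sets_mono (Set.inter_subset_inter_right _ fun m hm => hm.1) hE'⟩
    · refine ⟨_, Set.sdiff_subset, h, sets_mono ?_ empty_mem_sets⟩
      rintro m ⟨hm, hm'⟩
      exact hm'.2 ⟨m, hm, rfl⟩
  obtain ⟨D, hDB, hD, hQ⟩ := hJ.exists_positive_forall _ hsmall hB
  obtain ⟨E, hED, hE, hE'⟩ := hJ.exists_split hD
  refine ⟨E, hE.mono fun n hn => ⟨hDB (hED hn), hn⟩,
    hE'.mono (Set.sdiff_subset_sdiff_left hDB), fun i => ?_⟩
  obtain ⟨C, hC, hfin⟩ := hQ i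
  -- The finite error `D \ C` costs nothing because the fibres of `f i` are small on `A i`.
  refine sets_mono ?_ (union_mem_sets hC (inter_preimage_mem_sets_of_finite (hf i) hfin))
  rintro m ⟨hm, hmE⟩
  by_cases hmC : f i m ∈ C
  · exact Or.inl ⟨hm, hmC⟩
  · exact Or.inr ⟨hm, hED hmE, hmC⟩

/-- If `J.BWLe I` fails, then along `ω₁` there is a family splitting every `J`-positive set such that
every sequence avoids, on an `I`-positive set, all but countably many of its members. -/
theorem exists_family_of_not_BWLe (hJ : J.IsFSigma) (h : ¬ J.BWLe I)
    {K : Type*} [LinearOrder K] (hK : ∀ k : K, (Set.Iic k).Countable)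
    {F : K → M → N} (hF : F.Surjective) {G : K → Set N} (hG : G.Surjective) :
    ∃ D : K → Set N,
      (∀ B, J.Positive B → ∃ k, J.Positive (B ∩ D k) ∧ J.Positive (B \ D k)) ∧
      ∀ f : M → N, (∀ y, f ⁻¹' {y} ∈ I.sets) →
        ∃ A, I.Positive A ∧ {k | I.Positive (A ∩ f ⁻¹' D k)}.Countable := by
  have hw : ∀ f : M → N, ∃ A, I.Positive A ∧ ∀ B ⊆ f '' A, J.Positive B →
      ∃ C, J.Positive (C ∩ B) ∧ A ∩ f ⁻¹' C ∈ I.sets := by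
    intro f
    by_contra! hcon
    refine h ⟨f, fun A hA => ?_⟩
    obtain ⟨B, hBA, hB, hC⟩ := hcon A hA
    exact ⟨B, hBA, hB, hC⟩
  choose A hApos hA using hw
  -- `D k` splits `G k` and respects the maps `F j` with `j ≤ k`, which are countably many. A given
  -- `F j` can therefore fail only for `k < j`, again countably many indices. No `D k` depends on
  -- the others.
  have hD : ∀ k, ∃ D : Set N, (J.Positive (G k) → J.Positive (G k ∩ D) ∧ J.Positive (G k \ D)) ∧
      ∀ j ≤ k, (∀ y, F j ⁻¹' {y} ∈ I.sets) → A (F j) ∩ F j ⁻¹' D ∈ I.sets := by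
    intro k
    by_cases hk : J.Positive (G k)
    · have : Countable {j // j ≤ k ∧ ∀ y, F j ⁻¹' {y} ∈ I.sets} :=
        ((hK k).mono fun j hj => hj.1).to_subtype
      obtain ⟨D, h₁, h₂, h₃⟩ := hJ.exists_small_splitting
        (ι := {j // j ≤ k ∧ ∀ y, F j ⁻¹' {y} ∈ I.sets}) (f := fun j => F j)
        (A := fun j => A (F j)) (fun j y => sets_mono Set.inter_subset_right (j.2.2 y))
        (fun j => hA (F j)) hk
      exact ⟨D, fun _ => ⟨h₁, h₂⟩, fun j hj hj' => h₃ ⟨j, hj, hj'⟩⟩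
    · exact ⟨∅, fun h => absurd h hk, fun j _ _ => by simpa using empty_mem_sets⟩
  choose D hD₁ hD₂ using hD
  refine ⟨D, fun B hB => ?_, fun f hf => ?_⟩
  · obtain ⟨k, rfl⟩ := hG B
    exact ⟨k, hD₁ k hB⟩
  · obtain ⟨j, rfl⟩ := hF f
    refine ⟨A (F j), hApos _, (hK j).mono fun k hk => ?_⟩
    by_contra hkj
    exact hk (hD₂ k j (not_le.1 hkj).le hf)

end BWLe

end SetIdeal

/-! ### Enumeration under CH and conclusion -/

namespace SetIdeal

open Cardinal in
/-- Under CH there is a well-order of type `ω₁` along which the maps from a countable set to a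
countable set and the subsets of a countable set can be enumerated. -/
theorem exists_omega_one_enumeration (CH : Cardinal.aleph.{0} 1 = Cardinal.continuum.{0})
    (M : Type u) (N : Type v) [Countable M] [Countable N] [Nonempty N] :
    ∃ (K : Type w) (_ : LinearOrder K), Uncountable K ∧ (∀ k : K, (Set.Iic k).Countable) ∧
      (∃ F : K → M → N, F.Surjective) ∧ ∃ G : K → Set N, G.Surjective := by
  have hCH : (ℵ₁ : Cardinal.{w}) = 𝔠 := by
    simpa using congrArg Cardinal.lift.{w} CH
  have hK : #(ℵ₁ : Cardinal.{w}).ord.ToType = ℵ₁ := by simp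
  have hbound : ∀ {α : Type (max u v)}, #α ≤ 𝔠 → Nonempty α →
      ∃ g : (ℵ₁ : Cardinal.{w}).ord.ToType → α, g.Surjective := by
    intro α hα hne
    have hle : Cardinal.lift.{w} #α ≤ Cardinal.lift.{max u v} #(ℵ₁ : Cardinal.{w}).ord.ToType := by
      rw [hK, hCH]
      simpa using hα
    obtain ⟨e⟩ := Cardinal.lift_mk_le'.1 hle
    exact ⟨Function.invFun e, Function.invFun_surjective e.injective⟩
  refine ⟨(ℵ₁ : Cardinal.{w}).ord.ToType, inferInstance, ?_, fun k => ?_, ?_, ?_⟩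
  · rw [← Cardinal.aleph0_lt_mk_iff, hK]
    exact aleph0_lt_aleph_one
  · rw [← Set.Iio_insert]
    refine Set.Countable.insert _ ?_
    rw [← Cardinal.le_aleph0_iff_set_countable, ← lt_aleph_one_iff]
    exact (Cardinal.mk_Iio_lt k (by simp)).trans_eq hK
  · refine hbound ?_ inferInstance
    obtain ⟨e, he⟩ := exists_injective_nat M
    obtain ⟨e', he'⟩ := exists_injective_nat N
    -- A map is coded by its graph in `ℕ × ℕ`, so there are at most continuum many.
    have h : Function.Injective fun (f : M → N) => {p : ℕ × ℕ | ∃ m, p = (e m, e' (f m))} := by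
      intro f g hfg
      funext m
      have : (e m, e' (f m)) ∈ {p : ℕ × ℕ | ∃ m, p = (e m, e' (g m))} :=
        (Set.ext_iff.1 hfg _).1 ⟨m, rfl⟩
      obtain ⟨m', hm'⟩ := this
      obtain ⟨h₁, h₂⟩ := Prod.mk.inj hm'
      obtain rfl := he h₁
      exact he' h₂
    simpa using Cardinal.mk_le_of_injective (Equiv.ulift.{max u v}.symm.injective.comp h)
  · obtain ⟨e, he⟩ := exists_injective_nat N
    have h : Function.Injective fun s : ULift.{max u v} (Set N) =>
        ULift.up.{max u v} (e '' s.down) := by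
      intro s t hst
      exact ULift.down_injective (he.image_injective (ULift.up_injective hst))
    obtain ⟨G, hG⟩ := hbound (α := ULift.{max u v} (Set N))
      (by simpa using Cardinal.mk_le_of_injective h) inferInstance
    exact ⟨_, ULift.down_surjective.comp hG⟩

theorem exists_space_of_not_BWLe (CH : Cardinal.aleph.{0} 1 = Cardinal.continuum.{0})
    {M : Type u} {N : Type v} [Countable M] [Countable N]
    {I : SetIdeal M} {J : SetIdeal N} (hI : I.IsFSigma) (hJ : J.IsFSigma) (h : ¬ J.BWLe I) :
    ∃ (X : Type w) (_ : TopologicalSpace X),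
      T2Space X ∧ ¬ CompactSpace X ∧ I.BW X ∧ ¬ J.BW X := by
  have : Nonempty N := by
    by_contra hN
    rw [not_nonempty_iff] at hN
    exact J.univ_notMem_sets (finite_mem_sets Set.finite_univ)
  obtain ⟨K, _, _, hK, ⟨F, hF⟩, ⟨G, hG⟩⟩ := exists_omega_one_enumeration.{u, v, w} CH M N
  obtain ⟨D, hD₁, hD₂⟩ := exists_family_of_not_BWLe hJ h hK hF hG
  exact ⟨columnSpace D, inferInstance, inferInstance, not_compactSpace_columnSpace,
    BW_columnSpace hI hD₂, not_BW_columnSpace hD₁⟩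

end SetIdeal

theorem corollary5p3
    (CH : Cardinal.aleph.{0} 1 = Cardinal.continuum.{0})
    {M : Type u} {N : Type v} [Countable M] [Countable N]
    (I : SetIdeal M) (J : SetIdeal N) (hI : I.IsFSigma) (hJ : J.IsFSigma) :
    List.TFAE
      [ ¬ J.BWLe I,
        ∃ (X : Type w) (_ : TopologicalSpace X), I.BW X ∧ ¬ J.BW X,
        ∃ (X : Type w) (_ : TopologicalSpace X),
          T2Space X ∧ ¬ CompactSpace X ∧ I.BW X ∧ ¬ J.BW X ] ∧
    (I.BWLe J ↔ ∀ (X : Type w) [TopologicalSpace X], J.BW X → I.BW X) := by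
  refine ⟨?_, fun h X _ hX => h.BW hX, fun h => ?_⟩
  · tfae_have 1 → 3 := SetIdeal.exists_space_of_not_BWLe CH hI hJ
    tfae_have 3 → 2 := fun ⟨X, τ, _, _, hX, hX'⟩ => ⟨X, τ, hX, hX'⟩
    tfae_have 2 → 1 := fun ⟨X, _, hX, hX'⟩ h => hX' (h.BW hX)
    tfae_finish
  -- The same construction, with the roles of `I` and `J` exchanged.
  · by_contra hIJ
    obtain ⟨X, _, _, _, hX, hX'⟩ := SetIdeal.exists_space_of_not_BWLe.{v, u, w} CH hJ hI hIJ
    exact hX' (h X hX)
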